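/- Let $K$ be a field with $\operatorname{char} K\neq 2$, let $a,b\in K$, and suppose that $f(x)=x^6+ax^3+b$ is irreducible and separable over $K$. Put $\Delta=a^2-4b$ and $R(x)=x^3-3bx+ab$, and let $F$ be a splitting field of $f$ over $K$. Write $\zeta_3\in K$ if $K$ contains a primitive cubic root of unity, and $\sqrt[3]{b}\in K$ if at least one cubic root of $b$ lies in $K$ (so $\sqrt[3]{b}\notin K$ means that none does). Let $C_n$ be the cyclic group of order $n$, $S_3$ the symmetric group on three letters, and $D_6$ the dihedral group of order $12$. 1. Assume $\zeta_3\notin K$ and $-3\Delta$ is not a square in $K$. - If $\sqrt[3]{b}\in K$ or $R$ is reducible over $K$, then $\operatorname{Gal}(F/K)\cong D_6$. - If $\sqrt[3]{b}\notin K$ and $R$ is irreducible over $K$, then $\operatorname{Gal}(F/K)\cong S_3\times S_3$. 2. Assume $\zeta_3\notin K$ and $-3\Delta$ is a square in $K$. - If $\sqrt[3]{b}\in K$ and $R$ is irreducible over $K$, then $\operatorname{Gal}(F/K)\cong C_6$. - If $\sqrt[3]{b}\notin K$ and $R$ is reducible over $K$, then $\operatorname{Gal}(F/K)\cong S_3$.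 - If $\sqrt[3]{b}\notin K$ and $R$ is irreducible over $K$, then $\operatorname{Gal}(F/K)\cong C_3\times S_3$. 3. Assume $\zeta_3\in K$. - If $\sqrt[3]{b}\in K$ and $R$ is irreducible over $K$, then $\operatorname{Gal}(F/K)\cong S_3$. - If $\sqrt[3]{b}\notin K$ and $R$ is reducible over $K$, then $\operatorname{Gal}(F/K)\cong C_6$. - If $\sqrt[3]{b}\notin K$ and $R$ is irreducible over $K$, then $\operatorname{Gal}(F/K)\cong C_3\times S_3$. These are all the possible cases: it never happens that both $\sqrt[3]{b}\in K$ and $R$ is reducible over $K$. -/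

import Mathlib

open Polynomial

/-- The symmetric sextic trinomial `f(x) = x ^ 6 + a x ^ 3 + b`. -/
noncomputable def sextic {K : Type*} [Field K] (a b : K) : K[X] :=
  X ^ 6 + C a * X ^ 3 + C b

/-- The cubic `R(x) = x ^ 3 - 3 b x + a b`. -/
noncomputable def cubicR {K : Type*} [Field K] (a b : K) : K[X] :=
  X ^ 3 - C (3 * b) * X + C (a * b)

/-- `K` contains a primitive cubic root of unity. -/
def HasZeta3 (K : Type*) [Field K] : Prop :=
  ∃ ζ : K, IsPrimitiveRoot ζ 3

/-- At least one of the cubic roots of `b` lies in `K`. -/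
def HasCubeRoot {K : Type*} [Field K] (b : K) : Prop :=
  ∃ c : K, c ^ 3 = b

/-! ### Finite computations in S₃. -/

section PermFinThree

open Equiv

/-! Choose θ, φ in F with θ³, φ³ the roots of y² + ay + b, and put u = θφ, so u³ = b. The Galois
group G permutes the roots of x³ - b (cube-root-of-unity multiples of u) and those of R (u(θ + φ)
and its twists). Together these actions recover ω, θ, φ, so G embeds in S₃ × S₃
(`exists_pair_of_actions`). Up to squares the discriminants are -3 and -3Δ, which decides when each
action is even; a fixed point means a root in K. As Δ is not a square, the two signs differ on some
element, and 6 divides |G|.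

The rest is group theory. If neither action has a fixed point, the image contains A₃ × A₃ and is
determined by its signs (`exists_map_eq_and_map_eq`). An action with a fixed point is determined by
its sign (`eq_of_sign_eq_of_fixed`), so G embeds in a smaller group, and divisibility of |G| forces
equality. -/

theorem perm_fin_three_eq_one_or {x : Perm (Fin 3)} (hx : Perm.sign x = 1) :
    x = 1 ∨ x = finRotate 3 ∨ x = finRotate 3 ^ 2 := by
  revert x; decide

theorem perm_fin_three_eq_of_fixed {i : Fin 3} {x y : Perm (Fin 3)} (hx : x i = i) (hy : y i = i)
    (h : Perm.sign x = Perm.sign y) : x = y := by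
  revert i x y; decide

theorem conj_finRotate_three (x : Perm (Fin 3)) :
    (Perm.sign x = 1 → x * finRotate 3 * x⁻¹ = finRotate 3) ∧
      (Perm.sign x = -1 → x * finRotate 3 * x⁻¹ = finRotate 3 ^ 2) := by
  revert x; decide

theorem conj_finRotate_three_sq (x : Perm (Fin 3)) :
    (Perm.sign x = 1 → x * finRotate 3 ^ 2 * x⁻¹ = finRotate 3 ^ 2) ∧
      (Perm.sign x = -1 → x * finRotate 3 ^ 2 * x⁻¹ = finRotate 3) := by
  revert x; decide

/-- If none of the three is a 3-cycle, all are transpositions, and `s` differs from `t` or from `v`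
since no transposition moves every point; two distinct transpositions multiply to a 3-cycle. -/
theorem finRotate_three_mem_words : ∀ s t v : Perm (Fin 3), s 0 ≠ 0 ∧ t 1 ≠ 1 ∧ v 2 ≠ 2 →
    finRotate 3 ∈ [s, s ^ 2, t, t ^ 2, v, v ^ 2, s * t, t * s, s * v, v * s] := by
  decide

/-- The dihedral group of order `12` is the product of `S₃` with a group of order `2`. -/
theorem nonempty_dihedralGroup_six_mulEquiv :
    Nonempty (Perm (Fin 3) × ℤˣ ≃* DihedralGroup 6) := by
  let f : DihedralGroup 6 → Perm (Fin 3) × ℤˣ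
    | .r i => (finRotate 3 ^ i.val, (-1) ^ i.val)
    | .sr i => (swap 0 1 * finRotate 3 ^ i.val, (-1) ^ i.val)
  have hf : ∀ x y, f (x * y) = f x * f y := by decide
  have hinj : Function.Injective f := by
    have : ∀ x y, f x = f y → x = y := by decide
    exact fun x y => this x y
  have hbij : Function.Bijective f := by
    rw [Fintype.bijective_iff_injective_and_card]
    exact ⟨hinj, by decide⟩
  exact ⟨(MulEquiv.ofBijective (MonoidHom.mk' f hf) hbij).symm⟩

theorem card_alternatingGroup_fin_three : Nat.card (alternatingGroup (Fin 3)) = 3 := by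
  rw [Nat.card_eq_fintype_card]; decide

instance isCyclic_alternatingGroup_fin_three : IsCyclic (alternatingGroup (Fin 3)) :=
  have : Fact (Nat.Prime 3) := ⟨Nat.prime_three⟩
  isCyclic_of_prime_card card_alternatingGroup_fin_three

end PermFinThree

/-! ### Groups with two jointly faithful actions on three points. -/

section PairOfActions

open Equiv

variable {G : Type*} [Group G] (ρ₁ ρ₂ : G →* Perm (Fin 3))

theorem exists_map_eq_finRotate {ρ : G →* Perm (Fin 3)} (h : ¬ ∃ i, ∀ g, ρ g i = i) :
    ∃ g, ρ g = finRotate 3 := by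
  push Not at h
  obtain ⟨s, hs⟩ := h 0
  obtain ⟨t, ht⟩ := h 1
  obtain ⟨v, hv⟩ := h 2
  have h := finRotate_three_mem_words _ _ _ ⟨hs, ht, hv⟩
  simp only [← map_mul, ← map_pow, List.mem_cons, List.not_mem_nil, or_false] at h
  rcases h with h | h | h | h | h | h | h | h | h | h <;> exact ⟨_, h.symm⟩

theorem exists_map_eq_finRotate_and_even {ρ₁ : G →* Perm (Fin 3)} (ρ₂ : G →* Perm (Fin 3))
    (h : ¬ ∃ i, ∀ g, ρ₁ g i = i) :
    ∃ g, ρ₁ g = finRotate 3 ∧ Perm.sign (ρ₂ g) = 1 := by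
  obtain ⟨g, hg⟩ := exists_map_eq_finRotate h
  -- A fourth power fixes a 3-cycle and makes every sign trivial.
  refine ⟨g ^ 4, ?_, ?_⟩
  · rw [map_pow, hg]; decide
  · rw [map_pow, map_pow]
    rcases Int.units_eq_one_or (Perm.sign (ρ₂ g)) with h | h <;> rw [h] <;> decide

variable {ρ₁ ρ₂}

/-- If an odd-even twisting element is present, a "diagonal" element of order three splits. -/
theorem exists_map_eq_one_and_finRotate (h₁ : ¬ ∃ i, ∀ g, ρ₁ g i = i)
    (h₂ : ¬ ∃ i, ∀ g, ρ₂ g i = i) (hs : ∃ g, Perm.sign (ρ₁ g) ≠ Perm.sign (ρ₂ g)) :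
    ∃ g, ρ₁ g = 1 ∧ ρ₂ g = finRotate 3 := by
  obtain ⟨g, hg, hg'⟩ := exists_map_eq_finRotate_and_even ρ₂ h₁
  obtain ⟨k, hk, hk'⟩ := exists_map_eq_finRotate_and_even ρ₁ h₂
  obtain ⟨t, ht⟩ := hs
  have c2 := conj_finRotate_three (ρ₁ t)
  have d2 := conj_finRotate_three (ρ₂ t)
  have e2 := conj_finRotate_three_sq (ρ₂ t)
  have key : Perm.sign (ρ₁ t) = 1 ∧ Perm.sign (ρ₂ t) = -1 ∨
      Perm.sign (ρ₁ t) = -1 ∧ Perm.sign (ρ₂ t) = 1 := by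
    rcases Int.units_eq_one_or (Perm.sign (ρ₁ t)) with h | h <;>
      rcases Int.units_eq_one_or (Perm.sign (ρ₂ t)) with h' | h' <;> simp_all
  -- If `ρ₂ g` is trivial, a power of `g` corrects `k`. Otherwise conjugation by `t` inverts exactly
  -- one coordinate of `g`, so a word in `t * g * t⁻¹` and `g` cancels the first coordinate but not
  -- the second.
  rcases perm_fin_three_eq_one_or hg' with h | h | h
  · rcases perm_fin_three_eq_one_or hk' with h' | h' | h'
    · exact ⟨k, h', hk⟩
    · exact ⟨k * g ^ 2, by simp only [map_mul, map_pow, hg, h']; decide,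
        by simp only [map_mul, map_pow, h, hk]; decide⟩
    · exact ⟨k * g, by simp only [map_mul, hg, h']; decide,
        by simp only [map_mul, h, hk]; decide⟩
  · rcases key with ⟨p, q⟩ | ⟨p, q⟩
    · exact ⟨t * g * t⁻¹ * g ^ 2, by
        simp only [map_mul, map_pow, map_inv, hg, c2.1 p]; decide, by
        simp only [map_mul, map_pow, map_inv, h, d2.2 q]; decide⟩
    · exact ⟨(t * g * t⁻¹ * g) ^ 2, by
        simp only [map_mul, map_pow, map_inv, hg, c2.2 p]; decide, by
        simp only [map_mul, map_pow, map_inv, h, d2.1 q]; decide⟩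
  · rcases key with ⟨p, q⟩ | ⟨p, q⟩
    · exact ⟨(t * g * t⁻¹) ^ 2 * g, by
        simp only [map_mul, map_pow, map_inv, hg, c2.1 p]; decide, by
        simp only [map_mul, map_pow, map_inv, h, e2.2 q]; decide⟩
    · exact ⟨t * g * t⁻¹ * g, by
        simp only [map_mul, map_inv, hg, c2.2 p]; decide, by
        simp only [map_mul, map_inv, h, e2.1 q]; decide⟩

theorem exists_map_eq_one_and_even (h₁ : ¬ ∃ i, ∀ g, ρ₁ g i = i)
    (h₂ : ¬ ∃ i, ∀ g, ρ₂ g i = i) (hs : ∃ g, Perm.sign (ρ₁ g) ≠ Perm.sign (ρ₂ g))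
    {y : Perm (Fin 3)} (hy : Perm.sign y = 1) : ∃ g, ρ₁ g = 1 ∧ ρ₂ g = y := by
  obtain ⟨g, hg, hg'⟩ := exists_map_eq_one_and_finRotate h₁ h₂ hs
  rcases perm_fin_three_eq_one_or hy with rfl | rfl | rfl
  exacts [⟨1, by simp, by simp⟩, ⟨g, hg, hg'⟩, ⟨g ^ 2, by simp [hg], by rw [map_pow, hg']⟩]

/-- The joint image of two transitive actions is determined by its signs. -/
theorem exists_map_eq_and_map_eq (h₁ : ¬ ∃ i, ∀ g, ρ₁ g i = i)
    (h₂ : ¬ ∃ i, ∀ g, ρ₂ g i = i) (hs : ∃ g, Perm.sign (ρ₁ g) ≠ Perm.sign (ρ₂ g))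
    {x y : Perm (Fin 3)}
    (hxy : ∃ g, Perm.sign (ρ₁ g) = Perm.sign x ∧ Perm.sign (ρ₂ g) = Perm.sign y) :
    ∃ g, ρ₁ g = x ∧ ρ₂ g = y := by
  obtain ⟨t, ht₁, ht₂⟩ := hxy
  obtain ⟨g, hg, hg'⟩ := exists_map_eq_one_and_even h₁ h₂ hs (y := y * (ρ₂ t)⁻¹)
    (by simp [ht₂])
  obtain ⟨k, hk, hk'⟩ := exists_map_eq_one_and_even h₂ h₁ (hs.imp fun _ h => h.symm)
    (y := x * (ρ₁ t)⁻¹) (by simp [ht₁])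
  exact ⟨g * k * t, by simp [hg, hk'], by simp [hg', hk]⟩

/-- A point stabiliser in S₃ has order two, and sign is faithful on it. -/
theorem eq_of_sign_eq_of_fixed {ρ : G →* Perm (Fin 3)} (h : ∃ i, ∀ g, ρ g i = i) {g k : G}
    (hgk : Perm.sign (ρ g) = Perm.sign (ρ k)) : ρ g = ρ k :=
  h.elim fun _ hi => perm_fin_three_eq_of_fixed (hi g) (hi k) hgk

/-- The hypotheses keep the image in {±1}² out of each of the three subgroups of order two. -/
theorem exists_sign_pair (h₁ : ∃ g, Perm.sign (ρ₁ g) ≠ 1) (h₂ : ∃ g, Perm.sign (ρ₂ g) ≠ 1)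
    (hs : ∃ g, Perm.sign (ρ₁ g) ≠ Perm.sign (ρ₂ g)) (x y : ℤˣ) :
    ∃ g, Perm.sign (ρ₁ g) = x ∧ Perm.sign (ρ₂ g) = y := by
  obtain ⟨a, ha⟩ := h₁
  obtain ⟨b, hb⟩ := h₂
  obtain ⟨c, hc⟩ := hs
  have aux : ∀ a₁ a₂ b₁ b₂ c₁ c₂ x y : ℤˣ, a₁ ≠ 1 → b₂ ≠ 1 → c₁ ≠ c₂ →
      (1 = x ∧ 1 = y) ∨ (a₁ = x ∧ a₂ = y) ∨ (b₁ = x ∧ b₂ = y) ∨ (c₁ = x ∧ c₂ = y) ∨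
      (a₁ * b₁ = x ∧ a₂ * b₂ = y) ∨ (a₁ * c₁ = x ∧ a₂ * c₂ = y) ∨
        (b₁ * c₁ = x ∧ b₂ * c₂ = y) := by decide
  rcases aux _ (Perm.sign (ρ₂ a)) (Perm.sign (ρ₁ b)) _ _ _ x y ha hb hc with
    h | h | h | h | h | h | h
  exacts [⟨1, by simpa using h⟩, ⟨a, h⟩, ⟨b, h⟩, ⟨c, h⟩, ⟨a * b, by simpa using h⟩,
    ⟨a * c, by simpa using h⟩, ⟨b * c, by simpa using h⟩]


theorem nonempty_mulEquiv_of_injective_of_dvd {H : Type*} [Group H] [Finite H] (φ : G →* H)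
    (hφ : Function.Injective φ) (h : Nat.card H ∣ Nat.card G) : Nonempty (G ≃* H) := by
  have := Finite.of_injective φ hφ
  have : Function.Bijective φ := (Nat.bijective_iff_injective_and_card φ).2
    ⟨hφ, le_antisymm (Nat.card_le_card_of_injective φ hφ) (Nat.le_of_dvd Nat.card_pos h)⟩
  exact ⟨MulEquiv.ofBijective φ this⟩

theorem injective_prod_symm (hinj : Function.Injective (ρ₁.prod ρ₂)) :
    Function.Injective (ρ₂.prod ρ₁) := fun g k h => hinj <| by
  simp only [MonoidHom.prod_apply, Prod.mk.injEq] at h ⊢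
  exact h.symm

/-- G embeds in S₃ × {±1}, and all four sign pairs occur, so both 4 and 6 divide |G|. -/
theorem nonempty_mulEquiv_dihedralGroup_six (hinj : Function.Injective (ρ₁.prod ρ₂))
    (h6 : 6 ∣ Nat.card G) (hfix : ∃ i, ∀ g, ρ₁ g i = i) (h₁ : ∃ g, Perm.sign (ρ₁ g) ≠ 1)
    (h₂ : ∃ g, Perm.sign (ρ₂ g) ≠ 1) (hs : ∃ g, Perm.sign (ρ₁ g) ≠ Perm.sign (ρ₂ g)) :
    Nonempty (G ≃* DihedralGroup 6) := by
  have h4 : 4 ∣ Nat.card G := by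
    have := Subgroup.card_dvd_of_surjective ((Perm.sign.comp ρ₁).prod (Perm.sign.comp ρ₂))
      fun ⟨x, y⟩ => by
        obtain ⟨g, hg, hg'⟩ := exists_sign_pair h₁ h₂ hs x y
        exact ⟨g, Prod.ext hg hg'⟩
    simpa [Nat.card_prod, Nat.card_eq_fintype_card] using this
  obtain ⟨e⟩ := nonempty_mulEquiv_of_injective_of_dvd (ρ₂.prod (Perm.sign.comp ρ₁))
    (fun g k h => hinj <| by
      simp only [MonoidHom.prod_apply, MonoidHom.comp_apply, Prod.mk.injEq] at h ⊢
      exact ⟨eq_of_sign_eq_of_fixed hfix h.2, h.1⟩)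
    (by
      have : Nat.card (Perm (Fin 3) × ℤˣ) = 12 := by rw [Nat.card_eq_fintype_card]; decide
      rw [this]; omega)
  obtain ⟨e'⟩ := nonempty_dihedralGroup_six_mulEquiv
  exact ⟨e.trans e'⟩

theorem nonempty_mulEquiv_prod (hinj : Function.Injective (ρ₁.prod ρ₂))
    (hfix₁ : ¬ ∃ i, ∀ g, ρ₁ g i = i) (hfix₂ : ¬ ∃ i, ∀ g, ρ₂ g i = i)
    (h₁ : ∃ g, Perm.sign (ρ₁ g) ≠ 1)
    (h₂ : ∃ g, Perm.sign (ρ₂ g) ≠ 1) (hs : ∃ g, Perm.sign (ρ₁ g) ≠ Perm.sign (ρ₂ g)) :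
    Nonempty (G ≃* Perm (Fin 3) × Perm (Fin 3)) :=
  ⟨MulEquiv.ofBijective _ ⟨hinj, fun ⟨x, y⟩ => by
    obtain ⟨g, hg, hg'⟩ :=
      exists_map_eq_and_map_eq hfix₁ hfix₂ hs (exists_sign_pair h₁ h₂ hs (Perm.sign x) (Perm.sign y))
    exact ⟨g, Prod.ext hg hg'⟩⟩⟩

/-- An action by even permutations, with values in the alternating group. -/
def toAlternating (ρ : G →* Perm (Fin 3)) (h : ∀ g, Perm.sign (ρ g) = 1) :
    G →* alternatingGroup (Fin 3) :=
  ρ.codRestrict _ fun g => Perm.mem_alternatingGroup.2 (h g)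

theorem nonempty_mulEquiv_cyclic_six (hinj : Function.Injective (ρ₁.prod ρ₂))
    (h6 : 6 ∣ Nat.card G) (hfix : ∃ i, ∀ g, ρ₁ g i = i) (h₂ : ∀ g, Perm.sign (ρ₂ g) = 1) :
    Nonempty (G ≃* Multiplicative (ZMod 6)) := by
  have hcard : Nat.card (ℤˣ × alternatingGroup (Fin 3)) = 6 := by
    rw [Nat.card_prod, card_alternatingGroup_fin_three, Nat.card_eq_fintype_card]; decide
  obtain ⟨e⟩ := nonempty_mulEquiv_of_injective_of_dvd
    ((Perm.sign.comp ρ₁).prod (toAlternating ρ₂ h₂))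
    (fun g k h => hinj <| by
      simp only [MonoidHom.prod_apply, MonoidHom.comp_apply, Prod.mk.injEq] at h ⊢
      exact ⟨eq_of_sign_eq_of_fixed hfix h.1, congrArg Subtype.val h.2⟩)
    (by rwa [hcard])
  have : IsCyclic (ℤˣ × alternatingGroup (Fin 3)) := by
    refine (Group.isCyclic_prod_iff).2 ⟨inferInstance, inferInstance, ?_⟩
    rw [card_alternatingGroup_fin_three, Nat.card_eq_fintype_card]; decide
  exact ⟨e.trans (mulEquivOfCyclicCardEq (by rw [hcard]; simp))⟩

/-- An even permutation of three points with a fixed point is trivial, so `ρ₁` alone is faithful. -/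
theorem nonempty_mulEquiv_perm_three (hinj : Function.Injective (ρ₁.prod ρ₂))
    (h6 : 6 ∣ Nat.card G) (hfix : ∃ i, ∀ g, ρ₂ g i = i) (h₂ : ∀ g, Perm.sign (ρ₂ g) = 1) :
    Nonempty (G ≃* Perm (Fin 3)) :=
  nonempty_mulEquiv_of_injective_of_dvd ρ₁
    (fun g k h => hinj <| Prod.ext h <| eq_of_sign_eq_of_fixed hfix <| by rw [h₂, h₂])
    (by rwa [Nat.card_eq_fintype_card, Fintype.card_perm])

theorem nonempty_mulEquiv_cyclic_three_prod (hinj : Function.Injective (ρ₁.prod ρ₂))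
    (hfix₁ : ¬ ∃ i, ∀ g, ρ₁ g i = i) (hfix₂ : ¬ ∃ i, ∀ g, ρ₂ g i = i)
    (h₂ : ∀ g, Perm.sign (ρ₂ g) = 1) (hs : ∃ g, Perm.sign (ρ₁ g) ≠ Perm.sign (ρ₂ g)) :
    Nonempty (G ≃* Multiplicative (ZMod 3) × Perm (Fin 3)) := by
  have hbij : Function.Bijective ((toAlternating ρ₂ h₂).prod ρ₁) := by
    refine ⟨fun g k h => hinj <| ?_, fun ⟨y, x⟩ => ?_⟩
    · simp only [MonoidHom.prod_apply, Prod.mk.injEq] at h ⊢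
      exact ⟨h.2, congrArg Subtype.val h.1⟩
    · have hy := Perm.mem_alternatingGroup.1 y.2
      obtain ⟨g, hg, hg'⟩ := exists_map_eq_and_map_eq hfix₁ hfix₂ hs (x := x) (y := y) <| by
        obtain ⟨t, ht⟩ := hs
        rw [h₂] at ht
        rcases Int.units_eq_one_or (Perm.sign x) with h | h
        · exact ⟨1, by simp [h], by simp [hy]⟩
        · exact ⟨t, by rw [h]; exact (Int.units_eq_one_or _).resolve_left ht, by rw [hy, h₂]⟩
      exact ⟨g, Prod.ext (Subtype.ext hg') hg⟩
  exact ⟨(MulEquiv.ofBijective _ hbij).trans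
    ((mulEquivOfCyclicCardEq (by rw [card_alternatingGroup_fin_three]; simp)).prodCongr
      (MulEquiv.refl _))⟩

/-- Otherwise G would embed in {±1}², whose order 4 is not a multiple of 6. -/
theorem not_fixed_and_fixed (hinj : Function.Injective (ρ₁.prod ρ₂)) (h6 : 6 ∣ Nat.card G) :
    ¬ ((∃ i, ∀ g, ρ₁ g i = i) ∧ ∃ i, ∀ g, ρ₂ g i = i) := by
  rintro ⟨h₁, h₂⟩
  have := Subgroup.card_dvd_of_injective ((Perm.sign.comp ρ₁).prod (Perm.sign.comp ρ₂))
    fun g k h => hinj <| by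
      simp only [MonoidHom.prod_apply, MonoidHom.comp_apply, Prod.mk.injEq] at h ⊢
      exact ⟨eq_of_sign_eq_of_fixed h₁ h.1, eq_of_sign_eq_of_fixed h₂ h.2⟩
  have hc : Nat.card (ℤˣ × ℤˣ) = 4 := by rw [Nat.card_eq_fintype_card]; decide
  rw [hc] at this
  exact absurd (h6.trans this) (by decide)

end PairOfActions

/-! ### Galois action on the roots of a cubic. -/

section CubicAction

open Equiv

variable {K F : Type*} [Field K] [Field F] [Algebra K F]

/-- The automorphisms permute the three roots of a cubic over the base field. -/
theorem exists_perm_hom {p q : K} {r : Fin 3 → F} (hr : Function.Injective r)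
    (hpq : ∀ x, x ^ 3 + algebraMap K F p * x + algebraMap K F q =
      (x - r 0) * (x - r 1) * (x - r 2)) :
    ∃ ρ : (F ≃ₐ[K] F) →* Perm (Fin 3), ∀ σ i, σ (r i) = r (ρ σ i) := by
  have hroot : ∀ i, r i ^ 3 + algebraMap K F p * r i + algebraMap K F q = 0 := by
    intro i; rw [hpq]; fin_cases i <;> simp
  have h : ∀ (σ : F ≃ₐ[K] F) i, ∃ j, σ (r i) = r j := by
    intro σ i
    have h := congrArg σ (hroot i)
    simp only [map_add, map_mul, map_pow, AlgEquiv.commutes, map_zero] at h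
    rw [hpq, mul_eq_zero, mul_eq_zero, sub_eq_zero, sub_eq_zero, sub_eq_zero] at h
    rcases h with (h | h) | h
    exacts [⟨_, h⟩, ⟨_, h⟩, ⟨_, h⟩]
  choose f hf using h
  have hinj : ∀ σ, Function.Injective (f σ) := fun σ i j hij =>
    hr (σ.injective (by rw [hf, hf, hij]))
  refine ⟨MonoidHom.mk' (fun σ => Equiv.ofBijective (f σ) (Finite.injective_iff_bijective.1 (hinj σ)))
    fun σ τ => Equiv.ext fun i => hr ?_, fun σ i => hf σ i⟩
  simp [← hf]

/-- The root of the discriminant of a triple. -/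
def tripleDelta (r : Fin 3 → F) : F := (r 0 - r 1) * (r 1 - r 2) * (r 2 - r 0)

theorem tripleDelta_comp_perm (r : Fin 3 → F) (x : Perm (Fin 3)) :
    tripleDelta (r ∘ x) = ((Perm.sign x : ℤ) : F) * tripleDelta r := by
  have key : ∀ x : Perm (Fin 3), (Perm.sign x, x 0, x 1, x 2) ∈
      [((1 : ℤˣ), (0 : Fin 3), (1 : Fin 3), (2 : Fin 3)), (1, 1, 2, 0), (1, 2, 0, 1),
        (-1, 1, 0, 2), (-1, 0, 2, 1), (-1, 2, 1, 0)] := by decide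
  have := key x
  simp only [List.mem_cons, Prod.mk.injEq, List.not_mem_nil, or_false] at this
  unfold tripleDelta
  simp only [Function.comp_apply]
  rcases this with ⟨h, h0, h1, h2⟩ | ⟨h, h0, h1, h2⟩ | ⟨h, h0, h1, h2⟩ | ⟨h, h0, h1, h2⟩ |
    ⟨h, h0, h1, h2⟩ | ⟨h, h0, h1, h2⟩ <;> rw [h, h0, h1, h2] <;> push_cast <;> ring

theorem map_tripleDelta {r : Fin 3 → F} {ρ : (F ≃ₐ[K] F) →* Perm (Fin 3)}
    (hρ : ∀ σ i, σ (r i) = r (ρ σ i)) (σ : F ≃ₐ[K] F) :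
    σ (tripleDelta r) = ((Perm.sign (ρ σ) : ℤ) : F) * tripleDelta r := by
  rw [← tripleDelta_comp_perm]
  simp [tripleDelta, hρ]

variable [FiniteDimensional K F] [IsGalois K F]

theorem isSquare_iff_fixed {d : K} {δ : F} (h : δ ^ 2 = algebraMap K F d) :
    IsSquare d ↔ ∀ σ : F ≃ₐ[K] F, σ δ = δ := by
  rw [← IsGalois.mem_range_algebraMap_iff_fixed]
  constructor
  · rintro ⟨e, rfl⟩
    have : (δ - algebraMap K F e) * (δ + algebraMap K F e) = 0 := by
      linear_combination h.trans (map_mul _ e e)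
    rcases mul_eq_zero.1 this with h | h
    · exact ⟨e, (sub_eq_zero.1 h).symm⟩
    · exact ⟨-e, by rw [map_neg]; exact (eq_neg_of_add_eq_zero_left h).symm⟩
  · rintro ⟨e, rfl⟩
    rw [← map_pow] at h
    exact ⟨e, by rw [← (algebraMap K F).injective h, sq]⟩

theorem units_cast_mul_eq_self {s : ℤˣ} {x : F} (h2 : (2 : F) ≠ 0) (hx : x ≠ 0) :
    ((s : ℤ) : F) * x = x ↔ s = 1 := by
  rcases Int.units_eq_one_or s with rfl | rfl
  · simp
  · have : (-1 : ℤˣ) ≠ 1 := by decide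
    simp only [Units.val_neg, Units.val_one, Int.cast_neg, Int.cast_one, this, iff_false]
    intro h
    exact mul_ne_zero h2 hx (by linear_combination -h)

theorem exists_root_iff_exists_fixed {p q : K} {r : Fin 3 → F} (hr : Function.Injective r)
    (hpq : ∀ x, x ^ 3 + algebraMap K F p * x + algebraMap K F q =
      (x - r 0) * (x - r 1) * (x - r 2)) {ρ : (F ≃ₐ[K] F) →* Perm (Fin 3)}
    (hρ : ∀ σ i, σ (r i) = r (ρ σ i)) :
    (∃ c : K, c ^ 3 + p * c + q = 0) ↔ ∃ i, ∀ σ, ρ σ i = i := by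
  have h1 : ∀ c : K, c ^ 3 + p * c + q = 0 ↔ ∃ i, r i = algebraMap K F c := by
    intro c
    rw [← map_eq_zero (algebraMap K F)]
    simp only [map_add, map_mul, map_pow, hpq, mul_eq_zero, sub_eq_zero, Fin.exists_fin_succ]
    simp [eq_comm, or_assoc]
  have h2 : ∀ i, (∃ c : K, algebraMap K F c = r i) ↔ ∀ σ, ρ σ i = i := by
    intro i
    have := IsGalois.mem_range_algebraMap_iff_fixed (F := K) (r i)
    simp only [hρ, hr.eq_iff] at this
    exact this
  simp only [h1, ← h2]
  exact ⟨fun ⟨c, i, h⟩ => ⟨i, c, h.symm⟩, fun ⟨i, c, h⟩ => ⟨c, i, h.symm⟩⟩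

end CubicAction

/-! ### The sextic, its roots, and the two associated cubics. -/

section Sextic

variable {K : Type*} [Field K]

theorem sextic_monic (a b : K) : (sextic a b).Monic := by
  unfold sextic; monicity!

theorem sextic_natDegree (a b : K) : (sextic a b).natDegree = 6 := by
  unfold sextic; compute_degree!

theorem cubicR_natDegree (a b : K) : (cubicR a b).natDegree = 3 := by
  unfold cubicR; compute_degree!

theorem irreducible_cubicR_iff (a b : K) :
    Irreducible (cubicR a b) ↔ ¬ ∃ c : K, c ^ 3 + -(3 * b) * c + a * b = 0 := by
  have h0 : cubicR a b ≠ 0 := fun h => by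
    have := cubicR_natDegree a b
    simp [h] at this
  rw [irreducible_iff_roots_eq_zero_of_degree_le_three (by rw [cubicR_natDegree]; norm_num)
    (by rw [cubicR_natDegree]), Multiset.eq_zero_iff_forall_notMem]
  simp only [mem_roots h0, IsRoot.def, not_exists]
  refine forall_congr' fun c => not_congr (Eq.congr_left ?_)
  simp [cubicR]; ring

/-- In characteristic 3 the derivative vanishes, contradicting separability. -/
theorem three_ne_zero_of_sextic {a b : K} (hirr : Irreducible (sextic a b))
    (hsep : (sextic a b).Separable) : (3 : K) ≠ 0 := by
  intro h3
  have : derivative (sextic a b) = C (3 : K) * (2 * X ^ 5 + C a * X ^ 2) := by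
    simp [sextic, C_ofNat]; ring
  rw [h3, C_0, zero_mul] at this
  rw [separable_def, this, isCoprime_zero_right] at hsep
  exact hirr.not_isUnit hsep

theorem coeff_zero_ne_zero_of_sextic {a b : K} (hirr : Irreducible (sextic a b)) : b ≠ 0 := by
  rintro rfl
  have h : sextic a 0 = X * (X ^ 5 + C a * X ^ 2) := by simp [sextic]; ring
  rcases hirr.isUnit_or_isUnit h with h | h
  · exact not_isUnit_X h
  · have : (X ^ 5 + C a * X ^ 2 : K[X]).natDegree = 5 := by compute_degree!
    rw [natDegree_eq_zero_of_isUnit h] at this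
    omega

/-- A square root of Δ splits y² + ay + b, hence splits f into two cubics in x. -/
theorem not_isSquare_discr_of_sextic (h2 : (2 : K) ≠ 0) {a b : K}
    (hirr : Irreducible (sextic a b)) : ¬ IsSquare (a ^ 2 - 4 * b) := by
  rintro ⟨d, hd⟩
  have hfac : sextic a b = (X ^ 3 + C ((a + d) / 2)) * (X ^ 3 + C ((a - d) / 2)) := by
    have e1 : (a + d) / 2 + (a - d) / 2 = a := by field_simp; ring
    have e2 : (a + d) / 2 * ((a - d) / 2) = b := by
      field_simp; linear_combination hd
    calc sextic a b = X ^ 6 + C ((a + d) / 2 + (a - d) / 2) * X ^ 3 +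
          C ((a + d) / 2 * ((a - d) / 2)) := by rw [e1, e2]; rfl
      _ = _ := by rw [C_add, C_mul]; ring
  have hdeg : ∀ c : K, ¬ IsUnit (X ^ 3 + C c) := fun c h => by
    have : (X ^ 3 + C c : K[X]).natDegree = 3 := by compute_degree!
    rw [natDegree_eq_zero_of_isUnit h] at this
    omega
  rcases hirr.isUnit_or_isUnit hfac with h | h <;> exact hdeg _ h

theorem isSquare_mul_sq_iff {e d : K} (he : e ≠ 0) : IsSquare (e ^ 2 * d) ↔ IsSquare d := by
  constructor
  · rintro ⟨c, hc⟩
    exact ⟨c / e, by field_simp; linear_combination hc⟩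
  · rintro ⟨c, rfl⟩
    exact ⟨e * c, by ring⟩

theorem hasZeta3_iff (h2 : (2 : K) ≠ 0) (h3 : (3 : K) ≠ 0) : HasZeta3 K ↔ IsSquare (-3 : K) := by
  have hprim : ∀ ζ : K, ζ ^ 2 + ζ + 1 = 0 → IsPrimitiveRoot ζ 3 := by
    intro ζ h
    refine IsPrimitiveRoot.mk_of_lt ζ (by norm_num) (by linear_combination (ζ - 1) * h) ?_
    intro l hl hl'
    interval_cases l
    · intro h1; rw [pow_one] at h1; subst h1; exact h3 (by linear_combination h)
    · intro h1
      have : ζ = -2 := by linear_combination h - h1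
      rw [this] at h
      exact h3 (by linear_combination h)
  constructor
  · rintro ⟨ζ, hζ⟩
    have h := hζ.geom_sum_eq_zero (by norm_num)
    simp only [Finset.sum_range_succ, Finset.sum_range_zero, pow_zero, pow_one, zero_add] at h
    -- (2ζ + 1)² = 4(ζ² + ζ + 1) - 3.
    exact ⟨2 * ζ + 1, by linear_combination -4 * h⟩
  · rintro ⟨s, hs⟩
    exact ⟨(-1 + s) / 2, hprim _ (by field_simp; linear_combination -hs)⟩

variable {F : Type*} [Field F] [Algebra K F]

theorem exists_roots_of_sextic {a b : K} (hirr : Irreducible (sextic a b))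
    [IsSplittingField K F (sextic a b)] :
    ∃ θ φ ω : F, ω ^ 2 + ω + 1 = 0 ∧ θ ^ 3 + φ ^ 3 = - algebraMap K F a ∧
      θ ^ 3 * φ ^ 3 = algebraMap K F b := by
  have hs : (((sextic a b).map (algebraMap K F))).Splits := IsSplittingField.splits F (sextic a b)
  have hb : algebraMap K F b ≠ 0 := by
    simpa using coeff_zero_ne_zero_of_sextic hirr
  have hmonic := (sextic_monic a b).map (algebraMap K F)
  obtain ⟨θ, hθ⟩ := hs.exists_eval_eq_zero (by
    rw [degree_map, degree_eq_natDegree (sextic_monic a b).ne_zero, sextic_natDegree]; norm_num)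
  simp only [sextic, Polynomial.map_add, Polynomial.map_mul, Polynomial.map_pow, map_X, map_C,
    eval_add, eval_mul, eval_pow, eval_X, eval_C] at hθ
  set A := algebraMap K F a
  set B := algebraMap K F b
  -- Dividing out x³ - θ³ leaves a cubic with root φ; the quadratic factor of x³ - θ³ has a root θ',
  -- and ω = θ'/θ.
  have hfac : (sextic a b).map (algebraMap K F) =
      ((X - C θ) * (X ^ 2 + C θ * X + C (θ ^ 2))) * (X ^ 3 + C (A + θ ^ 3)) := by
    have hB : B = -(θ ^ 6 + A * θ ^ 3) := by linear_combination hθ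
    simp only [sextic, Polynomial.map_add, Polynomial.map_mul, Polynomial.map_pow, map_X, map_C]
    change X ^ 6 + C A * X ^ 3 + C B = _
    rw [hB]
    simp only [C_add, C_mul, C_pow, C_neg]
    ring
  have hθ0 : θ ≠ 0 := by
    rintro rfl
    exact hb (by linear_combination hθ)
  have hne : (X - C θ) * (X ^ 2 + C θ * X + C (θ ^ 2)) * (X ^ 3 + C (A + θ ^ 3)) ≠ 0 :=
    hfac ▸ hmonic.ne_zero
  rw [hfac] at hs
  have hs1 : (X ^ 3 + C (A + θ ^ 3)).Splits := hs.of_dvd hne (dvd_mul_left _ _)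
  have hs2 : (X ^ 2 + C θ * X + C (θ ^ 2)).Splits :=
    hs.of_dvd hne ((dvd_mul_left _ _).trans (dvd_mul_right _ _))
  obtain ⟨φ, hφ⟩ := hs1.exists_eval_eq_zero (by
    have : (X ^ 3 + C (A + θ ^ 3)).degree = 3 := by compute_degree!
    rw [this]; norm_num)
  obtain ⟨θ', hθ'⟩ := hs2.exists_eval_eq_zero (by
    have : (X ^ 2 + C θ * X + C (θ ^ 2)).degree = 2 := by compute_degree!
    rw [this]; norm_num)
  simp only [eval_add, eval_mul, eval_pow, eval_X, eval_C] at hφ hθ'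
  refine ⟨θ, φ, θ' / θ, ?_, by linear_combination hφ, ?_⟩
  · field_simp; linear_combination hθ'
  · linear_combination θ ^ 3 * hφ - hθ

theorem mul_cube_eq_of_cube_eq {ω x y : F} (hω : ω ^ 2 + ω + 1 = 0) (h : x ^ 3 = y ^ 3) :
    x = y ∨ x = ω * y ∨ x = ω ^ 2 * y := by
  have : (x - y) * ((x - ω * y) * (x - ω ^ 2 * y)) = 0 := by
    linear_combination h + (-x ^ 2 * y + ω * x * y ^ 2 - (ω - 1) * y ^ 3) * hω
  rcases mul_eq_zero.1 this with h | h
  · exact Or.inl (sub_eq_zero.1 h)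
  rcases mul_eq_zero.1 h with h | h
  exacts [Or.inr (Or.inl (sub_eq_zero.1 h)), Or.inr (Or.inr (sub_eq_zero.1 h))]

theorem algEquiv_eq_one_of_fixes {a b : K} [IsSplittingField K F (sextic a b)] {θ φ ω : F}
    (hω : ω ^ 2 + ω + 1 = 0) (hadd : θ ^ 3 + φ ^ 3 = - algebraMap K F a)
    (hmul : θ ^ 3 * φ ^ 3 = algebraMap K F b) {σ : F ≃ₐ[K] F} (h₁ : σ ω = ω) (h₂ : σ θ = θ)
    (h₃ : σ φ = φ) : σ = 1 := by
  have : (σ : F →ₐ[K] F) = AlgHom.id K F := by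
    refine AlgHom.ext_of_adjoin_eq_top (IsSplittingField.adjoin_rootSet F (sextic a b)) ?_
    intro z hz
    have hz := (mem_rootSet.1 hz).2
    simp only [sextic, map_add, map_mul, map_pow, aeval_X, aeval_C] at hz
    have : (z ^ 3 - θ ^ 3) * (z ^ 3 - φ ^ 3) = 0 := by
      linear_combination hz - z ^ 3 * hadd + hmul
    rcases mul_eq_zero.1 this with h | h <;>
      rcases mul_cube_eq_of_cube_eq hω (sub_eq_zero.1 h) with rfl | rfl | rfl <;>
      simp [h₁, h₂, h₃]
  exact AlgEquiv.ext fun z => DFunLike.congr_fun this z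

theorem six_dvd_card_of_sextic {a b : K} (hirr : Irreducible (sextic a b))
    (hsep : (sextic a b).Separable) [IsSplittingField K F (sextic a b)] :
    6 ∣ Nat.card (F ≃ₐ[K] F) := by
  have := IsSplittingField.finiteDimensional F (sextic a b)
  have := IsGalois.of_separable_splitting_field (E := F) hsep
  rw [IsGalois.card_aut_eq_finrank]
  obtain ⟨θ, φ, ω, -, hadd, hmul⟩ := exists_roots_of_sextic (F := F) hirr
  have hroot : aeval θ (sextic a b) = 0 := by
    simp only [sextic, map_add, map_mul, map_pow, aeval_X, aeval_C]
    linear_combination θ ^ 3 * hadd - hmul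
  have := minpoly.degree_dvd (K := K) (L := F) (x := θ) (IsIntegral.of_finite K θ)
  rwa [← minpoly.eq_of_irreducible_of_monic hirr hroot (sextic_monic a b),
    sextic_natDegree] at this

theorem injective_of_tripleDelta_ne_zero {r : Fin 3 → F} (h : tripleDelta r ≠ 0) :
    Function.Injective r := by
  simp only [tripleDelta, mul_ne_zero_iff, sub_ne_zero] at h
  obtain ⟨⟨h01, h12⟩, h20⟩ := h
  intro i j hij
  fin_cases i <;> fin_cases j <;> first | rfl | simp_all

theorem cardano_factorization {ω : F} (hω : ω ^ 2 + ω + 1 = 0) (s t x : F) :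
    x ^ 3 - 3 * (s * t) * x - (s ^ 3 + t ^ 3) =
      (x - (s + t)) * (x - (ω * s + ω ^ 2 * t)) * (x - (ω ^ 2 * s + ω * t)) := by
  linear_combination -(x - (s + t)) * (-(s + t) * x + (ω - 1) * (s ^ 2 + t ^ 2) +
    (ω ^ 2 - ω + 1) * (s * t)) * hω

/-- Each difference of roots is a constant times some s - ωᵏt, and these three factors multiply to
s³ - t³. -/
theorem tripleDelta_cardano {ω : F} (hω : ω ^ 2 + ω + 1 = 0) (s t : F) :
    tripleDelta ![s + t, ω * s + ω ^ 2 * t, ω ^ 2 * s + ω * t] =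
      -3 * (2 * ω + 1) * (s ^ 3 - t ^ 3) := by
  have h01 : s + t - (ω * s + ω ^ 2 * t) = (1 - ω) * (s - ω ^ 2 * t) := by
    linear_combination t * (1 - ω) * hω
  have h20 : ω ^ 2 * s + ω * t - (s + t) = (ω ^ 2 - 1) * (s - ω * t) := by
    linear_combination t * (ω - 1) * hω
  have h12 : ω * s + ω ^ 2 * t - (ω ^ 2 * s + ω * t) = (ω - ω ^ 2) * (s - t) := by ring
  have hc : (1 - ω) * (ω - ω ^ 2) * (ω ^ 2 - 1) = -3 * (2 * ω + 1) := by
    linear_combination (ω ^ 3 - 3 * ω ^ 2 + 2 * ω + 3) * hω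
  have hp : (s - t) * ((s - ω * t) * (s - ω ^ 2 * t)) = s ^ 3 - t ^ 3 := by
    linear_combination (-s ^ 2 * t + ω * s * t ^ 2 - (ω - 1) * t ^ 3) * hω
  simp only [tripleDelta, Matrix.cons_val_zero, Matrix.cons_val_one, Matrix.cons_val]
  rw [h01, h20, h12, ← hc, ← hp]
  ring

/-- The Galois group acts on the roots of `x ^ 3 - b` and of `R`, jointly faithfully. -/
theorem exists_pair_of_actions (h2 : (2 : K) ≠ 0) {a b : K} (hirr : Irreducible (sextic a b))
    (hsep : (sextic a b).Separable) [IsSplittingField K F (sextic a b)] :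
    ∃ ρ₁ ρ₂ : (F ≃ₐ[K] F) →* Equiv.Perm (Fin 3), Function.Injective (ρ₁.prod ρ₂) ∧
      (HasZeta3 K ↔ ∀ σ, Equiv.Perm.sign (ρ₁ σ) = 1) ∧
      (IsSquare (-3 * (a ^ 2 - 4 * b)) ↔ ∀ σ, Equiv.Perm.sign (ρ₂ σ) = 1) ∧
      (HasCubeRoot b ↔ ∃ i, ∀ σ, ρ₁ σ i = i) ∧
      (¬ Irreducible (cubicR a b) ↔ ∃ i, ∀ σ, ρ₂ σ i = i) ∧
      ∃ σ, Equiv.Perm.sign (ρ₁ σ) ≠ Equiv.Perm.sign (ρ₂ σ) := by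
  have h3 := three_ne_zero_of_sextic hirr hsep
  have hb := coeff_zero_ne_zero_of_sextic hirr
  have hΔ := not_isSquare_discr_of_sextic h2 hirr
  have := IsSplittingField.finiteDimensional F (sextic a b)
  have := IsGalois.of_separable_splitting_field (E := F) hsep
  obtain ⟨θ, φ, ω, hω, hadd, hmul⟩ := exists_roots_of_sextic (F := F) hirr
  set u := θ * φ with hu
  have hu3 : u ^ 3 = algebraMap K F b := by rw [hu, mul_pow, hmul]
  have h2F : (2 : F) ≠ 0 := by
    rw [← map_ofNat (algebraMap K F) 2]; exact (_root_.map_ne_zero _).2 h2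
  have hbF : algebraMap K F b ≠ 0 := (_root_.map_ne_zero _).2 hb
  have hu0 : u ≠ 0 := fun h => hbF (by rw [← hu3, h]; ring)
  -- The zero terms put x³ - b in Cardano form (s = u, t = 0). For R, s = uθ and t = uφ give st = b
  -- and s³ + t³ = -ab.
  let r₁ : Fin 3 → F := ![u + 0, ω * u + ω ^ 2 * 0, ω ^ 2 * u + ω * 0]
  let r₂ : Fin 3 → F :=
    ![u * θ + u * φ, ω * (u * θ) + ω ^ 2 * (u * φ), ω ^ 2 * (u * θ) + ω * (u * φ)]
  have hd₁ : tripleDelta r₁ ^ 2 = algebraMap K F ((3 * b) ^ 2 * -3) := by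
    rw [tripleDelta_cardano hω]
    simp only [map_mul, map_pow, map_neg, map_ofNat, ← hu3]
    linear_combination 36 * u ^ 6 * hω
  have hd₂ : tripleDelta r₂ ^ 2 = algebraMap K F ((3 * b) ^ 2 * (-3 * (a ^ 2 - 4 * b))) := by
    rw [tripleDelta_cardano hω]
    have ha : algebraMap K F a = -(θ ^ 3 + φ ^ 3) := by rw [hadd, neg_neg]
    simp only [map_mul, map_pow, map_neg, map_sub, map_ofNat, ha, ← hmul]
    rw [hu]
    linear_combination 36 * (θ * φ) ^ 6 * (θ ^ 3 - φ ^ 3) ^ 2 * hω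
  have hd₁₂ : (tripleDelta r₁ * tripleDelta r₂) ^ 2 =
      algebraMap K F ((27 * b ^ 2) ^ 2 * (a ^ 2 - 4 * b)) := by
    rw [mul_pow, hd₁, hd₂, ← map_mul]
    congr 1
    ring
  have h3b : 3 * b ≠ 0 := mul_ne_zero h3 hb
  have hδ₁ : tripleDelta r₁ ≠ 0 := fun h => by
    rw [h, zero_pow two_ne_zero, eq_comm, map_eq_zero] at hd₁
    exact mul_ne_zero (pow_ne_zero 2 h3b) (neg_ne_zero.2 h3) hd₁
  have hδ₂ : tripleDelta r₂ ≠ 0 := fun h => by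
    rw [h, zero_pow two_ne_zero, eq_comm, map_eq_zero] at hd₂
    refine mul_ne_zero (pow_ne_zero 2 h3b) (mul_ne_zero (neg_ne_zero.2 h3) fun h => hΔ ?_) hd₂
    rw [h]; exact IsSquare.zero
  have hpq₁ : ∀ x, x ^ 3 + algebraMap K F 0 * x + algebraMap K F (-b) =
      (x - r₁ 0) * (x - r₁ 1) * (x - r₁ 2) := by
    intro x
    refine Eq.trans ?_ (cardano_factorization hω u 0 x)
    rw [map_zero, map_neg, ← hu3]; ring
  have hpq₂ : ∀ x, x ^ 3 + algebraMap K F (-(3 * b)) * x + algebraMap K F (a * b) =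
      (x - r₂ 0) * (x - r₂ 1) * (x - r₂ 2) := by
    intro x
    refine Eq.trans ?_ (cardano_factorization hω (u * θ) (u * φ) x)
    simp only [map_neg, map_mul, map_ofNat]
    rw [hu]
    linear_combination (3 * x - algebraMap K F a) * hmul + θ ^ 3 * φ ^ 3 * hadd
  have hi₁ := injective_of_tripleDelta_ne_zero hδ₁
  have hi₂ := injective_of_tripleDelta_ne_zero hδ₂
  obtain ⟨ρ₁, hρ₁⟩ := exists_perm_hom hi₁ hpq₁
  obtain ⟨ρ₂, hρ₂⟩ := exists_perm_hom hi₂ hpq₂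
  refine ⟨ρ₁, ρ₂, ?_, ?_, ?_, ?_, ?_, ?_⟩
  -- The first action fixes u and ωu, hence ω; the second then gives a linear system for σθ and σφ,
  -- with nonzero determinant.
  · rw [injective_iff_map_eq_one]
    intro σ hσ
    simp only [MonoidHom.prod_apply, Prod.mk_eq_one] at hσ
    have e0 := hρ₁ σ 0
    have e1 := hρ₁ σ 1
    have f0 := hρ₂ σ 0
    have f1 := hρ₂ σ 1
    rw [hσ.1] at e0 e1
    rw [hσ.2] at f0 f1
    simp only [r₁, r₂, Equiv.Perm.coe_one, id_eq, Matrix.cons_val_zero, Matrix.cons_val_one,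
      map_add, map_mul, map_pow, mul_zero, add_zero] at e0 e1 f0 f1
    rw [e0] at e1 f0 f1
    have hσω : σ ω = ω := mul_right_cancel₀ hu0 e1
    rw [hσω] at f1
    have hω0 : ω - ω ^ 2 ≠ 0 := fun h => hδ₁ <| by
      rw [tripleDelta_cardano hω]
      have h1 : 2 * ω + 1 = 0 := by linear_combination hω + h
      rw [h1]; ring
    have hσθ : σ θ = θ := by
      refine mul_left_cancel₀ (mul_ne_zero hω0 hu0) ?_
      linear_combination f1 - ω ^ 2 * f0
    have hσφ : σ φ = φ := by
      rw [hσθ] at f0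
      refine mul_left_cancel₀ hu0 ?_
      linear_combination f0
    exact algEquiv_eq_one_of_fixes hω hadd hmul hσω hσθ hσφ
  · rw [hasZeta3_iff h2 h3, ← isSquare_mul_sq_iff h3b, isSquare_iff_fixed hd₁]
    exact forall_congr' fun σ => by rw [map_tripleDelta hρ₁, units_cast_mul_eq_self h2F hδ₁]
  · rw [← isSquare_mul_sq_iff h3b, isSquare_iff_fixed hd₂]
    exact forall_congr' fun σ => by rw [map_tripleDelta hρ₂, units_cast_mul_eq_self h2F hδ₂]
  · rw [← exists_root_iff_exists_fixed hi₁ hpq₁ hρ₁]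
    exact exists_congr fun c => by rw [zero_mul, add_zero, ← sub_eq_add_neg, sub_eq_zero]
  · rw [← exists_root_iff_exists_fixed hi₂ hpq₂ hρ₂, irreducible_cubicR_iff, not_not]
  -- Were the signs always equal, the product of the two discriminant roots would be fixed, making Δ
  -- a square.
  · by_contra! hs
    have h27 : 27 * b ^ 2 ≠ 0 := by
      rw [show 27 * b ^ 2 = 3 * (3 * b) ^ 2 by ring]
      exact mul_ne_zero h3 (pow_ne_zero 2 h3b)
    refine hΔ ((isSquare_mul_sq_iff h27).1 ((isSquare_iff_fixed hd₁₂).2 fun σ => ?_))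
    rw [map_mul, map_tripleDelta hρ₁, map_tripleDelta hρ₂, hs σ, mul_mul_mul_comm,
      ← Int.cast_mul, ← Units.val_mul, Int.units_mul_self]
    simp

end Sextic

/-! ### The classification. -/

theorem theorem1p1 {K : Type*} [Field K] (hchar : ringChar K ≠ 2) (a b Δ : K)
    (hirr : Irreducible (sextic a b)) (hsep : (sextic a b).Separable)
    (hΔ : Δ = a ^ 2 - 4 * b)
    (F : Type*) [Field F] [Algebra K F] [Polynomial.IsSplittingField K F (sextic a b)] :
    -- no primitive cubic root of unity in `K`, and `-3Δ` is not a square in `K`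
    (¬ HasZeta3 K → ¬ IsSquare (-3 * Δ) →
      (HasCubeRoot b ∨ ¬ Irreducible (cubicR a b) →
        Nonempty ((F ≃ₐ[K] F) ≃* DihedralGroup 6)) ∧
      (¬ HasCubeRoot b → Irreducible (cubicR a b) →
        Nonempty ((F ≃ₐ[K] F) ≃* Equiv.Perm (Fin 3) × Equiv.Perm (Fin 3)))) ∧
    -- no primitive cubic root of unity in `K`, and `-3Δ` is a square in `K`
    (¬ HasZeta3 K → IsSquare (-3 * Δ) →
      (HasCubeRoot b → Irreducible (cubicR a b) →
        Nonempty ((F ≃ₐ[K] F) ≃* Multiplicative (ZMod 6))) ∧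
      (¬ HasCubeRoot b → ¬ Irreducible (cubicR a b) →
        Nonempty ((F ≃ₐ[K] F) ≃* Equiv.Perm (Fin 3))) ∧
      (¬ HasCubeRoot b → Irreducible (cubicR a b) →
        Nonempty ((F ≃ₐ[K] F) ≃* Multiplicative (ZMod 3) × Equiv.Perm (Fin 3)))) ∧
    -- a primitive cubic root of unity in `K`
    (HasZeta3 K →
      (HasCubeRoot b → Irreducible (cubicR a b) →
        Nonempty ((F ≃ₐ[K] F) ≃* Equiv.Perm (Fin 3))) ∧
      (¬ HasCubeRoot b → ¬ Irreducible (cubicR a b) →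
        Nonempty ((F ≃ₐ[K] F) ≃* Multiplicative (ZMod 6))) ∧
      (¬ HasCubeRoot b → Irreducible (cubicR a b) →
        Nonempty ((F ≃ₐ[K] F) ≃* Multiplicative (ZMod 3) × Equiv.Perm (Fin 3)))) ∧
    -- these are all the possible cases: the one remaining combination never occurs
    ¬ (HasCubeRoot b ∧ ¬ Irreducible (cubicR a b)) := by
  subst hΔ
  have h2 : (2 : K) ≠ 0 := Ring.two_ne_zero hchar
  have h6 := six_dvd_card_of_sextic (F := F) hirr hsep
  obtain ⟨ρ₁, ρ₂, hinj, hζ, hΔ, hc, hR, hs⟩ := exists_pair_of_actions (F := F) h2 hirr hsep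
  -- Exchanging the two actions yields the cases with ζ₃ in K, and the dihedral case with R
  -- reducible.
  have hinj' := injective_prod_symm hinj
  have hs' : ∃ σ, Equiv.Perm.sign (ρ₂ σ) ≠ Equiv.Perm.sign (ρ₁ σ) := hs.imp fun _ h => h.symm
  have hR' := not_iff_not.2 hR
  rw [not_not] at hR'
  rw [hζ, hΔ, hc, hR', not_not]
  simp only [not_forall]
  refine ⟨fun h₁ h₂ => ⟨?_, fun hf₁ hf₂ => nonempty_mulEquiv_prod hinj hf₁ hf₂ h₁ h₂ hs⟩,
    fun _ h₂ => ⟨fun hf _ => nonempty_mulEquiv_cyclic_six hinj h6 hf h₂,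
      fun _ hf => nonempty_mulEquiv_perm_three hinj h6 hf h₂,
      fun hf₁ hf₂ => nonempty_mulEquiv_cyclic_three_prod hinj hf₁ hf₂ h₂ hs⟩,
    fun h₁ => ⟨fun hf _ => nonempty_mulEquiv_perm_three hinj' h6 hf h₁,
      fun _ hf => nonempty_mulEquiv_cyclic_six hinj' h6 hf h₁,
      fun hf₁ hf₂ => nonempty_mulEquiv_cyclic_three_prod hinj' hf₂ hf₁ h₁ hs'⟩,
    not_fixed_and_fixed hinj h6⟩
  rintro (hf | hf)
  · exact nonempty_mulEquiv_dihedralGroup_six hinj h6 hf h₁ h₂ hs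
  · exact nonempty_mulEquiv_dihedralGroup_six hinj' h6 hf h₂ h₁ hs'
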